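/- Let $\mathcal K^2$ be the set of convex bodies in $\mathbb R^2$, i.e. compact convex sets with non-empty interior. For sets $X,Y\subset\mathbb R^2$ and $\rho\in\mathbb R$ write $X+Y=\{x+y : x\in X,\ y\in Y\}$, $\rho X=\{\rho x : x\in X\}$, $X-Y=X+(-1)Y$ and $X^\circ=\{a\in\mathbb R^2 : a^Tx\le 1 \text{ for all } x\in X\}$. Write $K\subset^{opt}C$ ($K$ is optimally contained in $C$) if $K\subset C$ and $K\not\subset t+\rho C$ for all $0\le\rho<1$ and $t\in\mathbb R^2$. The Minkowski asymmetry of $C\in\mathcal K^2$ is $s(C)=\inf\{\rho>0 : C-c\subset\rho(c-C)\text{ for some }c\in\mathbb R^2\}$, and $C$ is called Minkowski centered if $C\subset s(C)(-C)$. Let $\varphi=\frac{1+\sqrt5}{2}$. Theorem. Let $C\in\mathcal K^2$ be Minkowski centered such that $$\left(\frac{C^\circ-C^\circ}{2}\right)^{\circ}\subset^{opt}\frac{C-C}{2}.$$ Then $s(C)\le\varphi$. Moreover, if $s(C)=\varphi$, then there exists a non-singular linear transformation $L$ of $\mathbb R^2$ such that $L(C)=\mathbb{GH}$, where $$\mathbb{GH}=\mathrm{conv}\left(\left\{(-1,-1)^T,\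 (-1,0)^T,\ (0,\varphi)^T,\ (1,0)^T,\ (1,-1)^T\right\}\right)$$ is the golden house. -/

import Mathlib

open scoped Pointwise

noncomputable section

/-- A convex body: a compact convex set that is full-dimensional, that is, has interior points. -/
structure IsConvexBody {E : Type*} [NormedAddCommGroup E] [NormedSpace ℝ E] (C : Set E) :
    Prop where
  convex : Convex ℝ C
  isCompact : IsCompact C
  interior_nonempty : (interior C).Nonempty

/-- The (one-sided) polar `{a | aᵀ x ≤ 1 for all x ∈ K}` of a set. -/
def polarSet {E : Type*} [NormedAddCommGroup E] [InnerProductSpace ℝ E] (K : Set E) : Set E :=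
  {a | ∀ x ∈ K, inner ℝ a x ≤ 1}

/-- The arithmetic symmetrization `(C - C) / 2` (a Minkowski difference of sets). -/
def arithmeticSymmetrization {E : Type*} [NormedAddCommGroup E] [InnerProductSpace ℝ E]
    (C : Set E) : Set E :=
  (1 / 2 : ℝ) • (C - C)

/-- The harmonic symmetrization `((C° - C°) / 2)°`. -/
def harmonicSymmetrization {E : Type*} [NormedAddCommGroup E] [InnerProductSpace ℝ E]
    (C : Set E) : Set E :=
  polarSet ((1 / 2 : ℝ) • (polarSet C - polarSet C))

/-- `K` is optimally contained in `C`: it is contained in `C`, but in no translate of a dilatate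
`ρ C` with `0 ≤ ρ < 1`. -/
def OptimallyContained {E : Type*} [NormedAddCommGroup E] [NormedSpace ℝ E] (K C : Set E) :
    Prop :=
  K ⊆ C ∧ ∀ (ρ : ℝ) (t : E), 0 ≤ ρ → ρ < 1 → ¬ K ⊆ {t} + ρ • C

/-- The Minkowski asymmetry `inf {ρ > 0 | C - c ⊆ ρ (c - C) for some c}`. -/
def minkowskiAsymmetry {E : Type*} [NormedAddCommGroup E] [NormedSpace ℝ E] (C : Set E) : ℝ :=
  sInf {ρ : ℝ | 0 < ρ ∧ ∃ c : E, C - {c} ⊆ ρ • ({c} - C)}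

/-- `c` is a Minkowski center of `C`: `C - c ⊆ s(C) (c - C)`. -/
def IsMinkowskiCenter {E : Type*} [NormedAddCommGroup E] [NormedSpace ℝ E] (C : Set E) (c : E) :
    Prop :=
  C - {c} ⊆ minkowskiAsymmetry C • ({c} - C)

/-- `C` is Minkowski centered: the origin is a Minkowski center. -/
def IsMinkowskiCentered {E : Type*} [NormedAddCommGroup E] [NormedSpace ℝ E] (C : Set E) : Prop :=
  IsMinkowskiCenter C 0

/-- The golden house, a pentagon in the Euclidean plane. -/
def goldenHouse : Set (EuclideanSpace ℝ (Fin 2)) :=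
  convexHull ℝ {!₂[-1, -1], !₂[-1, 0], !₂[0, Real.goldenRatio], !₂[1, 0], !₂[1, -1]}

end

/-! ### Polars, gauges and the antipodal pair -/

section Polar

variable {E : Type*} [NormedAddCommGroup E] [InnerProductSpace ℝ E]

/-! Assume `s = s(C) ≥ φ`. Two facts pin `C` down. First, optimal containment gives a common
boundary point `p` of the two symmetrizations; comparing the gauges of `p` and `-p` with the width
of `C` shows that `±p ∈ C` and that `C` lies in a strip `|⟪e, ·⟫| ≤ 1` with `±p` on its two boundary
lines (`exists_antipodal_pair_of_optimallyContained`). Second, since no translation improves the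
Minkowski center, `0` is a convex combination of functionals `a ∈ C°` attaining `-s` on `C`
(`zero_mem_convexHull_touching`); in the plane three suffice.

In coordinates adapted to the strip, one of the three functionals has the sign opposite to the other
two in the direction along the strip. Their bounds on `±p` and on each other's touching points
reduce to `(s² - s - 1) + s x₃² ≤ 0` (`golden_core`). Hence `s = φ` with equality throughout, which
fixes the functionals and their touching points. The functionals and the strip cut out the golden
house; the touching points and `±p` are its vertices. -/

theorem mem_smul_of_forall_polarSet_inner_le [CompleteSpace E] {C : Set E} (hconv : Convex ℝ C)
    (hclosed : IsClosed C) (h0 : (0 : E) ∈ C) {α : ℝ} (hα : 0 < α) {x : E}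
    (h : ∀ a ∈ polarSet C, inner ℝ a x ≤ α) : x ∈ α • C := by
  rw [Set.mem_smul_set_iff_inv_smul_mem₀ hα.ne']
  by_contra hx
  obtain ⟨g, u, hgu, hux⟩ := geometric_hahn_banach_closed_point hconv hclosed hx
  have hu : 0 < u := by simpa using hgu 0 h0
  have hmem : u⁻¹ • (InnerProductSpace.toDual ℝ E).symm g ∈ polarSet C := by
    intro c hc
    rw [real_inner_smul_left, InnerProductSpace.toDual_symm_apply, inv_mul_le_iff₀ hu, mul_one]
    exact (hgu c hc).le
  have h1 := h _ hmem
  rw [real_inner_smul_left, InnerProductSpace.toDual_symm_apply, inv_mul_le_iff₀ hu] at h1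
  rw [map_smul, smul_eq_mul, lt_inv_mul_iff₀ hα] at hux
  linarith

theorem zero_mem_polarSet (C : Set E) : (0 : E) ∈ polarSet C := by
  intro c _
  simp

theorem isClosed_polarSet (C : Set E) : IsClosed (polarSet C) := by
  simp only [polarSet, Set.ofPred_forall]
  exact isClosed_biInter fun c _ => isClosed_le (by fun_prop) continuous_const

theorem isCompact_polarSet [FiniteDimensional ℝ E] {C : Set E} (h0 : (0 : E) ∈ interior C) :
    IsCompact (polarSet C) := by
  have := FiniteDimensional.proper ℝ E
  obtain ⟨r, hr, hrC⟩ := Metric.isOpen_iff.mp isOpen_interior 0 h0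
  refine Metric.isCompact_of_isClosed_isBounded (isClosed_polarSet C) ?_
  refine (Metric.isBounded_closedBall (x := (0 : E)) (r := 2 / r)).subset fun a ha => ?_
  rw [mem_closedBall_zero_iff]
  rcases eq_or_ne a 0 with rfl | hne
  · simp only [norm_zero]
    positivity
  have hn : 0 < ‖a‖ := norm_pos_iff.mpr hne
  have hmem : (r / 2 / ‖a‖) • a ∈ C := by
    refine interior_subset (hrC ?_)
    rw [mem_ball_zero_iff, norm_smul, Real.norm_of_nonneg (by positivity), div_mul_cancel₀ _ hn.ne']
    linarith
  have h1 := ha _ hmem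
  rw [real_inner_smul_right, real_inner_self_eq_norm_sq] at h1
  have h2 : r / 2 / ‖a‖ * ‖a‖ ^ 2 = r / 2 * ‖a‖ := by field_simp
  rw [h2] at h1
  rw [le_div_iff₀ hr]
  linarith

/-- Otherwise the gauge of `M` has a maximum below `1` on the compact set `K`, so `K` fits into a
smaller dilate. Only the translation `t = 0` is needed. -/
theorem exists_mem_notMem_interior_of_optimallyContained {K M : Set E} (hK : IsCompact K)
    (hM : IsClosed M) (hMc : Convex ℝ M) (h0 : (0 : E) ∈ interior M)
    (h : OptimallyContained K M) : ∃ p ∈ K, p ∉ interior M := by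
  by_contra! hint
  have hnhds : M ∈ nhds (0 : E) := mem_interior_iff_mem_nhds.mp h0
  rcases K.eq_empty_or_nonempty with rfl | hne
  · exact h.2 0 0 le_rfl one_pos (Set.empty_subset _)
  obtain ⟨q, hq, hmax⟩ := hK.exists_isMaxOn hne (continuous_gauge hMc hnhds).continuousOn
  have hq1 : gauge M q < 1 := (gauge_lt_one_iff_mem_interior hMc hnhds).mpr (hint q hq)
  obtain ⟨ρ, hρ, hρ1⟩ := exists_between hq1
  have hρ0 : 0 < ρ := (gauge_nonneg q).trans_lt hρ
  refine h.2 ρ 0 hρ0.le hρ1 fun x hx => ?_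
  rw [Set.singleton_add, Set.image_add_left, Set.mem_preimage, neg_zero, zero_add,
    Set.mem_smul_set_iff_inv_smul_mem₀ hρ0.ne', ← hM.closure_eq,
    ← gauge_le_one_iff_mem_closure hMc hnhds, gauge_smul_of_nonneg (by positivity), smul_eq_mul,
    inv_mul_le_iff₀ hρ0, mul_one]
  exact (hmax hx).trans hρ.le

/-- Let `α`, `β` be the support values of `C°` at `p` and `-p`, so `α + β ≤ 2`. As `p/α` and `-p/β`
lie in `C`, the width bound gives `1/α + 1/β ≤ 2`. The arithmetic and harmonic means then force `α =
β = 1`. -/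
theorem mem_of_inner_sub_polarSet_le [CompleteSpace E] {C : Set E} (hconv : Convex ℝ C)
    (hclosed : IsClosed C) (h0 : (0 : E) ∈ C) {e p : E} (hp : inner ℝ e p = 1)
    (hdiff : ∀ c ∈ C, ∀ d ∈ C, inner ℝ e c - inner ℝ e d ≤ 2)
    (hpolar : ∀ a ∈ polarSet C, ∀ b ∈ polarSet C, inner ℝ a p - inner ℝ b p ≤ 2) :
    p ∈ C ∧ -p ∈ C := by
  set S : Set ℝ := (fun a => inner ℝ a p) '' polarSet C
  have hSne : S.Nonempty := ⟨_, 0, zero_mem_polarSet C, rfl⟩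
  have hle : ∀ a ∈ polarSet C, ∀ b ∈ polarSet C, inner ℝ a p ≤ 2 + inner ℝ b p := fun a ha b hb => by
    linarith [hpolar a ha b hb]
  have habove : BddAbove S := ⟨2, by
    rintro _ ⟨a, ha, rfl⟩
    simpa using hle a ha 0 (zero_mem_polarSet C)⟩
  have hbelow : BddBelow S := ⟨-2, by
    rintro _ ⟨a, ha, rfl⟩
    have := hle 0 (zero_mem_polarSet C) a ha
    simp only [inner_zero_left] at this
    change -2 ≤ inner ℝ a p
    linarith⟩
  set α := sSup S
  set β := -sInf S
  have hαβ : α + β ≤ 2 := by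
    have : α ≤ 2 + sInf S := by
      refine csSup_le hSne ?_
      rintro _ ⟨a, ha, rfl⟩
      rw [← sub_le_iff_le_add']
      refine le_csInf hSne ?_
      rintro _ ⟨b, hb, rfl⟩
      change inner ℝ a p - 2 ≤ inner ℝ b p
      linarith [hle a ha b hb]
    simp only [β]
    linarith
  have hα : 0 < α := by
    -- Since `0 ∈ C`, the width bound alone gives `⟪e, ·⟫ ≤ 2` on `C`.
    have hm : (1 / 2 : ℝ) • e ∈ polarSet C := fun c hc => by
      have := hdiff c hc 0 h0
      rw [inner_zero_right] at this
      rw [real_inner_smul_left]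
      linarith
    have : inner ℝ ((1 / 2 : ℝ) • e) p ≤ α := le_csSup habove ⟨_, hm, rfl⟩
    rw [real_inner_smul_left, hp] at this
    linarith
  have hβ : 0 < β := by
    have hm : (-1 / 2 : ℝ) • e ∈ polarSet C := fun c hc => by
      have := hdiff 0 h0 c hc
      rw [inner_zero_right] at this
      rw [real_inner_smul_left]
      linarith
    have : sInf S ≤ inner ℝ ((-1 / 2 : ℝ) • e) p := csInf_le hbelow ⟨_, hm, rfl⟩
    rw [real_inner_smul_left, hp] at this
    simp only [β]
    linarith
  have hpα : p ∈ α • C := mem_smul_of_forall_polarSet_inner_le hconv hclosed h0 hα fun a ha =>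
    le_csSup habove ⟨a, ha, rfl⟩
  have hpβ : -p ∈ β • C := mem_smul_of_forall_polarSet_inner_le hconv hclosed h0 hβ fun a ha => by
    rw [inner_neg_right]
    exact neg_le_neg (csInf_le hbelow ⟨a, ha, rfl⟩)
  have hαβ' : α = 1 ∧ β = 1 := by
    obtain ⟨c, hc, hcp⟩ := hpα
    obtain ⟨d, hd, hdp⟩ := hpβ
    have h1 : α * inner ℝ e c = 1 := by rw [← hp, ← hcp, real_inner_smul_right]
    have h2 : β * inner ℝ e d = -1 := by
      rw [← real_inner_smul_right]
      change inner ℝ e (β • d) = -1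
      rw [show β • d = -p from hdp, inner_neg_right, hp]
    have h3 := hdiff c hc d hd
    have h4 : α + β ≤ 2 * (α * β) := by
      nlinarith [mul_le_mul_of_nonneg_left h3 (mul_pos hα hβ).le]
    have h5 : (α - β) ^ 2 ≤ 0 := by
      nlinarith [mul_le_mul_of_nonneg_left hαβ (add_pos hα hβ).le]
    have h6 : α = β := by nlinarith [sq_nonneg (α - β)]
    rw [← h6] at h4 hαβ ⊢
    have h7 : α = 1 := by nlinarith
    exact ⟨h7, h7⟩
  rw [hαβ'.1, one_smul] at hpα
  rw [hαβ'.2, one_smul] at hpβ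
  exact ⟨hpα, hpβ⟩

theorem exists_antipodal_pair_of_optimallyContained [FiniteDimensional ℝ E] {C : Set E}
    (hC : IsConvexBody C) (h0 : (0 : E) ∈ interior C)
    (hopt : OptimallyContained (harmonicSymmetrization C) (arithmeticSymmetrization C)) :
    ∃ p e : E, p ∈ C ∧ -p ∈ C ∧ inner ℝ e p = 1 ∧ ∀ c ∈ C, |inner ℝ e c| ≤ 1 := by
  have h0C := interior_subset h0
  have hMcomp : IsCompact (arithmeticSymmetrization C) := by
    have := (hC.isCompact.prod hC.isCompact).image continuous_sub
    rw [Set.sub_image_prod] at this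
    exact this.smul _
  have hMconv : Convex ℝ (arithmeticSymmetrization C) := (hC.convex.sub hC.convex).smul _
  have hKcomp : IsCompact (harmonicSymmetrization C) :=
    hMcomp.of_isClosed_subset (isClosed_polarSet _) hopt.1
  have h0M : (0 : E) ∈ interior (arithmeticSymmetrization C) := by
    rw [mem_interior_iff_mem_nhds]
    have h2 : (1 / 2 : ℝ) • C ⊆ arithmeticSymmetrization C :=
      Set.smul_set_mono fun c hc => ⟨c, hc, 0, h0C, sub_zero c⟩
    refine Filter.mem_of_superset ?_ h2
    rw [set_smul_mem_nhds_zero_iff (by norm_num)]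
    exact mem_interior_iff_mem_nhds.mp h0
  obtain ⟨p, hpK, hpM⟩ := exists_mem_notMem_interior_of_optimallyContained hKcomp
    hMcomp.isClosed hMconv h0M hopt
  obtain ⟨f, hf⟩ := geometric_hahn_banach_open_point hMconv.interior isOpen_interior hpM
  have hfp : 0 < f p := by simpa using hf 0 h0M
  have hfM : ∀ m ∈ arithmeticSymmetrization C, f m ≤ f p := by
    intro m hm
    have : m ∈ closure (interior (arithmeticSymmetrization C)) := by
      rw [hMconv.closure_interior_eq_closure_of_nonempty_interior ⟨0, h0M⟩]
      exact subset_closure hm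
    have hcl : IsClosed {x | f x ≤ f p} := isClosed_le f.continuous continuous_const
    exact closure_minimal (fun x hx => (hf x hx).le) hcl this
  set e := (f p)⁻¹ • (InnerProductSpace.toDual ℝ E).symm f with he
  have hinner : ∀ x, inner ℝ e x = (f p)⁻¹ * f x := fun x => by
    rw [he, real_inner_smul_left, InnerProductSpace.toDual_symm_apply]
  have hep : inner ℝ e p = 1 := by rw [hinner, inv_mul_cancel₀ hfp.ne']
  have hdiff : ∀ c ∈ C, ∀ d ∈ C, inner ℝ e c - inner ℝ e d ≤ 2 := fun c hc d hd => by
    have h1 := hfM ((1 / 2 : ℝ) • (c - d)) (Set.smul_mem_smul_set ⟨c, hc, d, hd, rfl⟩)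
    rw [map_smul, smul_eq_mul, map_sub] at h1
    rw [hinner, hinner, ← mul_sub, inv_mul_le_iff₀ hfp]
    linarith
  have hpolar : ∀ a ∈ polarSet C, ∀ b ∈ polarSet C, inner ℝ a p - inner ℝ b p ≤ 2 :=
    fun a ha b hb => by
      have h1 := hpK ((1 / 2 : ℝ) • (a - b)) (Set.smul_mem_smul_set ⟨a, ha, b, hb, rfl⟩)
      rw [real_inner_comm, real_inner_smul_left, inner_sub_left] at h1
      linarith
  obtain ⟨hp, hnp⟩ := mem_of_inner_sub_polarSet_le hC.convex hC.isCompact.isClosed h0C hep hdiff hpolar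
  refine ⟨p, e, hp, hnp, hep, fun c hc => abs_le.mpr ⟨?_, ?_⟩⟩
  · have := hdiff p hp c hc
    linarith
  · have := hdiff c hc (-p) hnp
    rw [inner_neg_right] at this
    linarith

end Polar

/-! ### Carathéodory in the plane and compactness -/

theorem exists_three_point_convexComb {E : Type*} [AddCommGroup E] [Module ℝ E]
    [FiniteDimensional ℝ E] (hE : Module.finrank ℝ E = 2) {A : Set E} {x : E}
    (hx : x ∈ convexHull ℝ A) :
    ∃ w ∈ stdSimplex ℝ (Fin 3), ∃ z : Fin 3 → E, (∀ i, z i ∈ A) ∧ ∑ i, w i • z i = x := by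
  obtain ⟨ι, _, z, w, hz, hind, hw, hsum, hcomb⟩ := eq_pos_convex_span_of_mem_convexHull hx
  have hcard : Fintype.card ι ≤ 3 := by
    have h1 := hind.card_le_finrank_succ
    have h2 := Submodule.finrank_le (vectorSpan ℝ (Set.range z))
    omega
  have hne : Nonempty ι := by
    by_contra h
    rw [not_nonempty_iff] at h
    simp at hsum
  -- Pad to exactly three points, with weight zero on the new indices.
  obtain ⟨g⟩ : Nonempty (ι ↪ Fin 3) :=
    Function.Embedding.nonempty_of_card_le (by simpa using hcard)
  have hext : ∀ i, Function.extend g w (0 : Fin 3 → ℝ) (g i) = w i := fun i => g.injective.extend_apply w _ i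
  have hzext : ∀ i, Function.invFun g (g i) = i := Function.leftInverse_invFun g.injective
  have hout : ∀ j ∉ Set.range g, Function.extend g w (0 : Fin 3 → ℝ) j = 0 := fun j hj =>
    Function.extend_apply' w _ j fun ⟨i, hi⟩ => hj ⟨i, hi⟩
  refine ⟨Function.extend g w (0 : Fin 3 → ℝ), ⟨fun j => ?_, ?_⟩, fun j => z (Function.invFun g j),
    fun j => hz ⟨_, rfl⟩, ?_⟩
  · by_cases hj : j ∈ Set.range g
    · obtain ⟨i, rfl⟩ := hj
      rw [hext]
      exact (hw i).le
    · rw [hout j hj]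
  · rw [← hsum]
    exact (Fintype.sum_of_injective g g.injective _ _ hout fun i => (hext i).symm).symm
  · rw [← hcomb]
    refine (Fintype.sum_of_injective g g.injective _ _ (fun j hj => ?_) fun i => ?_).symm
    · rw [hout j hj, zero_smul]
    · simp only [hext, hzext]

theorem isCompact_convexHull_of_finrank_eq_two {E : Type*} [NormedAddCommGroup E]
    [NormedSpace ℝ E] [FiniteDimensional ℝ E] (hE : Module.finrank ℝ E = 2) {A : Set E}
    (hA : IsCompact A) : IsCompact (convexHull ℝ A) := by
  have himage : convexHull ℝ A = (fun q : (Fin 3 → ℝ) × (Fin 3 → E) => ∑ i, q.1 i • q.2 i) ''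
      (stdSimplex ℝ (Fin 3) ×ˢ Set.univ.pi fun _ => A) := by
    ext x
    constructor
    · intro hx
      obtain ⟨w, hw, z, hz, rfl⟩ := exists_three_point_convexComb hE hx
      exact ⟨(w, z), ⟨hw, fun i _ => hz i⟩, rfl⟩
    · rintro ⟨⟨w, z⟩, ⟨hw, hz⟩, rfl⟩
      exact (convex_convexHull ℝ A).sum_mem (fun i _ => hw.1 i) hw.2
        fun i _ => subset_convexHull ℝ A (hz i trivial)
  rw [himage]
  refine ((isCompact_stdSimplex ℝ (Fin 3)).prod (isCompact_univ_pi fun _ => hA)).image ?_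
  fun_prop

/-- Where `G < 0` any `ε > 0` works; on the compact rest `F` stays away from `s` and `G` is bounded.
-/
theorem IsCompact.exists_pos_forall_add_mul_lt {X : Type*} [TopologicalSpace X] {S : Set X}
    (hS : IsCompact S) {F G : X → ℝ} (hF : Continuous F) (hG : Continuous G) {s : ℝ}
    (hle : ∀ x ∈ S, F x ≤ s) (hlt : ∀ x ∈ S, F x = s → G x < 0) :
    ∃ ε > 0, ∀ x ∈ S, F x + ε * G x < s := by
  have hT : IsCompact (S ∩ {x | 0 ≤ G x}) :=
    hS.inter_right (isClosed_le continuous_const hG)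
  rcases (S ∩ {x | 0 ≤ G x}).eq_empty_or_nonempty with hempty | hne
  · refine ⟨1, one_pos, fun x hx => ?_⟩
    have : G x < 0 := by
      by_contra! h
      exact (Set.eq_empty_iff_forall_notMem.mp hempty x) ⟨hx, h⟩
    linarith [hle x hx]
  obtain ⟨y, hy, hFy⟩ := hT.exists_isMaxOn hne hF.continuousOn
  obtain ⟨z, hz, hGz⟩ := hT.exists_isMaxOn hne hG.continuousOn
  have hys : F y < s := lt_of_le_of_ne (hle y hy.1) fun h => (hlt y hy.1 h).not_ge hy.2
  have hz0 : 0 ≤ G z := hz.2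
  -- The `+ 1` covers the case where the maximum of `G` is `0`.
  refine ⟨(s - F y) / (G z + 1), div_pos (by linarith) (by linarith), fun x hx => ?_⟩
  rcases lt_or_ge (G x) 0 with hneg | hnonneg
  · have := mul_neg_of_pos_of_neg (div_pos (by linarith : 0 < s - F y) (by linarith : 0 < G z + 1)) hneg
    linarith [hle x hx]
  · have h1 : F x ≤ F y := hFy ⟨hx, hnonneg⟩
    have h2 : G x ≤ G z := hGz ⟨hx, hnonneg⟩
    have h3 : (s - F y) / (G z + 1) * G x < s - F y := by
      rw [div_mul_eq_mul_div, div_lt_iff₀ (by linarith)]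
      exact mul_lt_mul_of_pos_left (by linarith) (by linarith)
    linarith

/-! ### Minkowski asymmetry and touching functionals -/

section Asymmetry

variable {E : Type*} [NormedAddCommGroup E] [NormedSpace ℝ E] {C : Set E}

theorem minkowskiAsymmetry_le_of_forall_sub_mem {ρ : ℝ} (hρ : 0 < ρ) {v : E}
    (h : ∀ y ∈ C, v - y ∈ ρ • C) : minkowskiAsymmetry C ≤ ρ := by
  -- The center `v / (1 + ρ)` is the fixed point of `y ↦ (v - y) / ρ`.
  refine csInf_le ⟨0, fun r hr => hr.1.le⟩ ⟨hρ, (1 + ρ)⁻¹ • v, ?_⟩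
  rintro _ ⟨y, hy, c, rfl, rfl⟩
  obtain ⟨d, hd, hdv⟩ := h y hy
  refine ⟨(1 + ρ)⁻¹ • v - d, ⟨_, rfl, d, hd, rfl⟩, ?_⟩
  change ρ • ((1 + ρ)⁻¹ • v - d) = y - (1 + ρ)⁻¹ • v
  have hv : v = (1 + ρ) • (1 + ρ)⁻¹ • v := by rw [smul_inv_smul₀ (by linarith)]
  have hdv' : ρ • d = v - y := hdv
  rw [smul_sub, hdv']
  nth_rewrite 2 [hv]
  rw [add_smul, one_smul]
  abel

theorem IsMinkowskiCentered.exists_neg_eq_smul (h : IsMinkowskiCentered C) {y : E} (hy : y ∈ C) :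
    ∃ d ∈ C, -y = minkowskiAsymmetry C • d := by
  obtain ⟨_, ⟨_, rfl, d, hd, rfl⟩, hdy⟩ := h ⟨y, hy, 0, rfl, rfl⟩
  refine ⟨d, hd, ?_⟩
  have : minkowskiAsymmetry C • ((0 : E) - d) = y - 0 := hdy
  rw [zero_sub, smul_neg, sub_zero] at this
  rw [← this, neg_neg]

theorem IsMinkowskiCentered.zero_mem_interior (h : IsMinkowskiCentered C) (hC : IsConvexBody C)
    (hs : 0 < minkowskiAsymmetry C) : (0 : E) ∈ interior C := by
  obtain ⟨x, hx⟩ := hC.interior_nonempty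
  obtain ⟨d, hd, hxd⟩ := h.exists_neg_eq_smul (interior_subset hx)
  set s := minkowskiAsymmetry C
  have := hC.convex.combo_interior_self_mem_interior hx hd (a := 1 / (1 + s)) (b := s / (1 + s))
    (by positivity) (by positivity) (by field_simp)
  convert this using 1
  rw [div_eq_inv_mul s, mul_smul, ← hxd, smul_neg, one_div, add_neg_cancel]

end Asymmetry

/-- If `0` could be separated from the touching functionals, some `v` would be negative on all of
them. A small shift by `ε v` would then relax every tight constraint and give a ratio `ρ < s`. -/
theorem zero_mem_convexHull_touching {E : Type*} [NormedAddCommGroup E] [InnerProductSpace ℝ E]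
    [FiniteDimensional ℝ E] (hE : Module.finrank ℝ E = 2) {C : Set E} (hC : IsConvexBody C)
    (h : IsMinkowskiCentered C) (hs : 0 < minkowskiAsymmetry C) :
    (0 : E) ∈ convexHull ℝ
      {a | a ∈ polarSet C ∧ ∃ y ∈ C, inner ℝ a y = -minkowskiAsymmetry C} := by
  set s := minkowskiAsymmetry C with hs_def
  set A := {a | a ∈ polarSet C ∧ ∃ y ∈ C, inner ℝ a y = -s} with hA_def
  have h0 := h.zero_mem_interior hC hs
  have hP := isCompact_polarSet h0
  have hPC := hP.prod hC.isCompact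
  have hA : IsCompact A := by
    have himage : A = Prod.fst '' ((polarSet C ×ˢ C) ∩ {q : E × E | inner ℝ q.1 q.2 = -s}) := by
      ext a
      constructor
      · rintro ⟨ha, y, hy, hay⟩
        exact ⟨(a, y), ⟨⟨ha, hy⟩, hay⟩, rfl⟩
      · rintro ⟨⟨a, y⟩, ⟨⟨ha, hy⟩, hay⟩, rfl⟩
        exact ⟨ha, y, hy, hay⟩
    rw [himage]
    exact (hPC.inter_right (isClosed_eq (by fun_prop) continuous_const)).image continuous_fst
  by_contra hmem
  obtain ⟨f, u, hfu, huf⟩ := geometric_hahn_banach_point_closed (convex_convexHull ℝ A)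
    (isCompact_convexHull_of_finrank_eq_two hE hA).isClosed hmem
  rw [map_zero] at hfu
  set v := -(InnerProductSpace.toDual ℝ E).symm f with hv
  have hAv : ∀ a ∈ A, inner ℝ a v < 0 := fun a ha => by
    rw [hv, inner_neg_right, real_inner_comm, InnerProductSpace.toDual_symm_apply]
    linarith [huf a (subset_convexHull ℝ A ha)]
  obtain ⟨ε, hε, hlt⟩ := hPC.exists_pos_forall_add_mul_lt
    (F := fun q : E × E => -inner ℝ q.1 q.2) (G := fun q : E × E => inner ℝ q.1 v) (s := s)
    (by fun_prop) (by fun_prop)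
    (by
      rintro ⟨a, y⟩ ⟨ha, hy⟩
      obtain ⟨d, hd, hyd⟩ := h.exists_neg_eq_smul hy
      change -inner ℝ a y ≤ s
      rw [← inner_neg_right, hyd, real_inner_smul_right]
      exact mul_le_of_le_one_right hs.le (ha d hd))
    (by
      rintro ⟨a, y⟩ ⟨ha, hy⟩ hay
      refine hAv a ⟨ha, y, hy, ?_⟩
      rw [← hay, neg_neg])
  obtain ⟨q, hqmem, hq⟩ := hPC.exists_isMaxOn ⟨(0, 0), zero_mem_polarSet C, interior_subset h0⟩
    (f := fun q : E × E => -inner ℝ q.1 q.2 + ε * inner ℝ q.1 v) (by fun_prop)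
  obtain ⟨ρ, hρ, hρs⟩ := exists_between
    (max_lt hs (hlt q hqmem))
  obtain ⟨hρ0, hqρ⟩ := max_lt_iff.mp hρ
  refine hρs.not_ge (minkowskiAsymmetry_le_of_forall_sub_mem hρ0 (v := ε • v) fun y hy => ?_)
  refine mem_smul_of_forall_polarSet_inner_le hC.convex hC.isCompact.isClosed
    (interior_subset h0) hρ0 fun a ha => ?_
  have h1 : -inner ℝ a y + ε * inner ℝ a v ≤ _ := hq (Set.mk_mem_prod ha hy)
  rw [inner_sub_right, real_inner_smul_right]
  linarith

/-! ### The extremal inequality -/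

/-- Here `xᵢ = ⟪e, yᵢ⟫`, `bᵢ = ⟪aᵢ, u⟫`, `t = ⟪a₃, p⟫`, and `τᵢ` is the value of `aᵢ` on `p + t u`,
a vector in the kernel of `a₃`. Eliminating the `τᵢ`, then the `bᵢ`, then `t` leaves an inequality
in `s` and `x₃` alone. -/
theorem golden_core {s x₁ x₂ x₃ t b₁ b₂ τ₁ τ₂ : ℝ} (hs : Real.goldenRatio ≤ s)
    (hx₁ : -1 ≤ x₁) (hx₂ : x₂ ≤ 1) (hx₃ : 0 ≤ x₃) (hb₁ : 0 < b₁)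
    (hτ₁ : 0 ≤ τ₁) (hτ₂ : τ₂ ≤ 0) (ht₁ : τ₁ - b₁ * t ≤ 1) (ht₂ : -1 ≤ τ₂ - b₂ * t)
    (h₁ : s ≤ b₁ - τ₁ * x₁) (h₂ : s ≤ b₂ - τ₂ * x₂)
    (h₃₁ : τ₁ * x₃ + b₁ * s ≤ 1) (h₃₂ : τ₂ * x₃ + b₂ * s ≤ 1) (hx₃' : x₃ ≤ 1) (ht : |t| ≤ 1) :
    s = Real.goldenRatio ∧ x₃ = 0 ∧ t = 0 ∧ b₁ = s - 1 ∧ b₂ = s - 1 ∧ τ₁ = 1 ∧ τ₂ = -1 ∧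
      x₁ = -1 ∧ x₂ = 1 := by
  have hg := Real.goldenRatio_sq
  have hg1 := Real.one_lt_goldenRatio
  have ht' := abs_le.mp ht
  have hs2 : s + 1 ≤ s ^ 2 := by nlinarith
  have hs1 : 1 < s := by linarith
  have e₁ : s - b₁ ≤ τ₁ := by nlinarith
  have e₂ : s - b₂ ≤ -τ₂ := by nlinarith
  have f₁ : s - 1 ≤ b₁ * (1 + t) := by linarith
  have f₂ : s - 1 ≤ b₂ * (1 - t) := by linarith
  have g₁ : b₁ * (s - x₃) ≤ 1 - s * x₃ := by nlinarith
  have g₂ : b₂ * (s + t * x₃) ≤ 1 + x₃ := by nlinarith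
  have k₁ : (s - 1) * (s - x₃) ≤ (1 + t) * (1 - s * x₃) := by
    linarith [mul_le_mul_of_nonneg_right f₁ (by linarith : 0 ≤ s - x₃),
      mul_le_mul_of_nonneg_left g₁ (by linarith : 0 ≤ 1 + t)]
  have hst : 0 ≤ s + t * x₃ := by nlinarith
  have k₂ : t * (1 + s * x₃) ≤ 1 + x₃ - s * (s - 1) := by
    linarith [mul_le_mul_of_nonneg_right f₂ hst,
      mul_le_mul_of_nonneg_left g₂ (by linarith : 0 ≤ 1 - t)]
  have hsx : 0 ≤ 1 - s * x₃ := by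
    nlinarith [mul_pos hb₁ (by linarith : 0 < s - x₃)]
  -- Weighting `k₁` by `1 + s x₃` and `k₂` by `1 - s x₃` cancels `t`.
  have key : 2 * (s ^ 2 - s - 1) + 2 * s * x₃ ^ 2 ≤ 0 := by
    have h0 : 0 < 1 + s * x₃ := by positivity
    linarith [mul_le_mul_of_nonneg_right k₁ h0.le, mul_le_mul_of_nonneg_right k₂ hsx]
  have hx0 : x₃ = 0 := by
    have : s * x₃ ^ 2 ≤ 0 := by linarith
    have : x₃ ^ 2 ≤ 0 := nonpos_of_mul_nonpos_right this (by linarith)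
    exact pow_eq_zero_iff two_ne_zero |>.mp (le_antisymm this (sq_nonneg x₃))
  subst hx0
  simp only [mul_zero, add_zero, sub_zero, zero_add, mul_one] at *
  have hsg : s = Real.goldenRatio := by
    refine le_antisymm ?_ hs
    by_contra! hlt
    nlinarith
  have hss : s * s = s + 1 := by rw [hsg, ← sq]; exact hg
  have ht0 : t = 0 := by linarith
  subst ht0
  simp only [mul_zero, add_zero, sub_zero, mul_one] at *
  have hb1 : b₁ = s - 1 :=
    le_antisymm (le_of_mul_le_mul_right (by linarith : b₁ * s ≤ (s - 1) * s) (by linarith)) f₁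
  have hb2 : b₂ = s - 1 :=
    le_antisymm (le_of_mul_le_mul_right (by linarith : b₂ * s ≤ (s - 1) * s) (by linarith)) f₂
  have hτ1 : τ₁ = 1 := by linarith
  have hτ2 : τ₂ = -1 := by linarith
  subst hτ1 hτ2
  exact ⟨hsg, trivial, trivial, hb1, hb2, rfl, rfl, by linarith, by linarith⟩

/-! ### Recovering the golden house -/

theorem mem_goldenHouse {q : EuclideanSpace ℝ (Fin 2)} (h₁ : |q 0| ≤ 1) (h₂ : -1 ≤ q 1)
    (h₃ : q 0 + (Real.goldenRatio - 1) * q 1 ≤ 1)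
    (h₄ : -q 0 + (Real.goldenRatio - 1) * q 1 ≤ 1) : q ∈ goldenHouse := by
  have hg : (Real.goldenRatio - 1) * Real.goldenRatio = 1 := by
    linarith [Real.goldenRatio_sq, sq Real.goldenRatio]
  have hg1 := Real.one_lt_goldenRatio
  obtain ⟨h₅, h₆⟩ := abs_le.mp h₁
  set v : Fin 5 → EuclideanSpace ℝ (Fin 2) :=
    ![!₂[-1, -1], !₂[-1, 0], !₂[0, Real.goldenRatio], !₂[1, 0], !₂[1, -1]] with hv
  have hmem : ∀ i, v i ∈ ({!₂[-1, -1], !₂[-1, 0], !₂[0, Real.goldenRatio], !₂[1, 0], !₂[1, -1]} :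
      Set (EuclideanSpace ℝ (Fin 2))) := by
    intro i
    fin_cases i <;> simp [hv]
  have hsum : ∀ w : Fin 5 → ℝ, (∀ i, 0 ≤ w i) → ∑ i, w i = 1 → ∑ i, w i • v i ∈ goldenHouse :=
    fun w hw hw1 => (convex_convexHull ℝ _).sum_mem (fun i _ => hw i) hw1
      fun i _ => subset_convexHull ℝ _ (hmem i)
  rcases le_total (q 1) 0 with hy | hy
  -- Bilinear weights on the corners of the rectangle.
  · convert hsum ![-q 1 * ((1 - q 0) / 2), (1 + q 1) * ((1 - q 0) / 2), 0,
      (1 + q 1) * ((1 + q 0) / 2), -q 1 * ((1 + q 0) / 2)] ?_ ?_ using 1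
    · ext i
      fin_cases i <;> simp [hv, Fin.sum_univ_five] <;> ring
    · intro i
      fin_cases i <;> simp <;> nlinarith
    · simp [Fin.sum_univ_five]
      ring
  -- Barycentric weights in the roof triangle; the apex weight is `q 1 / φ = (φ - 1) q 1`.
  · convert hsum ![0, (1 - (Real.goldenRatio - 1) * q 1 - q 0) / 2, (Real.goldenRatio - 1) * q 1,
      (1 - (Real.goldenRatio - 1) * q 1 + q 0) / 2, 0] ?_ ?_ using 1
    · ext i
      fin_cases i
      · simp [hv, Fin.sum_univ_five]
        ring
      · simp [hv, Fin.sum_univ_five]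
        linear_combination (-q 1) * hg
    · have := mul_nonneg (sub_nonneg.mpr hg1.le) hy
      intro i
      fin_cases i <;> simp <;> linarith
    · simp [Fin.sum_univ_five]
      ring

/-- The linear coordinates `(⟪e, z⟫, W z)` with respect to the basis `p, u`. -/
noncomputable def planarCoordinates {p u e : EuclideanSpace ℝ (Fin 2)} {W : EuclideanSpace ℝ (Fin 2) →ₗ[ℝ] ℝ}
    (hdecomp : ∀ z, z = inner ℝ e z • p + W z • u) (hep : inner ℝ e p = 1)
    (heu : inner ℝ e u = 0) (hWp : W p = 0) (hWu : W u = 1) :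
    EuclideanSpace ℝ (Fin 2) ≃ₗ[ℝ] EuclideanSpace ℝ (Fin 2) where
  toFun z := !₂[inner ℝ e z, W z]
  invFun q := q 0 • p + q 1 • u
  map_add' y z := by
    ext i
    fin_cases i <;> simp [inner_add_right]
  map_smul' c z := by
    ext i
    fin_cases i <;> simp [real_inner_smul_right]
  left_inv z := by simpa using (hdecomp z).symm
  right_inv q := by
    ext i
    fin_cases i <;> simp [inner_add_right, real_inner_smul_right, hep, heu, hWp, hWu]

theorem eq_goldenHouse_of_normalized_touching {C : Set (EuclideanSpace ℝ (Fin 2))} (hC : Convex ℝ C)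
    {p u e : EuclideanSpace ℝ (Fin 2)} {W : EuclideanSpace ℝ (Fin 2) →ₗ[ℝ] ℝ}
    (hdecomp : ∀ z, z = inner ℝ e z • p + W z • u) (hep : inner ℝ e p = 1)
    (heu : inner ℝ e u = 0) (hWp : W p = 0) (hWu : W u = 1)
    (hp : p ∈ C) (hnp : -p ∈ C) (hstrip : ∀ c ∈ C, |inner ℝ e c| ≤ 1)
    {s : ℝ} (hs : Real.goldenRatio ≤ s) {a₁ a₂ a₃ y₁ y₂ y₃ : EuclideanSpace ℝ (Fin 2)}
    (ha₁ : a₁ ∈ polarSet C) (ha₂ : a₂ ∈ polarSet C) (ha₃ : a₃ ∈ polarSet C)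
    (hy₁ : y₁ ∈ C) (hy₂ : y₂ ∈ C) (hy₃ : y₃ ∈ C) (h₁ : inner ℝ a₁ y₁ = -s)
    (h₂ : inner ℝ a₂ y₂ = -s) (h₃ : inner ℝ a₃ y₃ = -s)
    (hb₁ : 0 < inner ℝ a₁ u) (hb₂ : 0 < inner ℝ a₂ u) (hb₃ : inner ℝ a₃ u = -1)
    (hτ₁ : 0 ≤ inner ℝ a₁ p + inner ℝ a₁ u * inner ℝ a₃ p)
    (hτ₂ : inner ℝ a₂ p + inner ℝ a₂ u * inner ℝ a₃ p ≤ 0) :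
    s = Real.goldenRatio ∧
      ∃ L : EuclideanSpace ℝ (Fin 2) ≃ₗ[ℝ] EuclideanSpace ℝ (Fin 2), L '' C = goldenHouse := by
  have hin : ∀ a z : EuclideanSpace ℝ (Fin 2),
      inner ℝ a z = inner ℝ e z * inner ℝ a p + W z * inner ℝ a u := fun a z => by
    nth_rewrite 1 [hdecomp z]
    rw [inner_add_right, real_inner_smul_right, real_inner_smul_right]
  have hap : ∀ a ∈ polarSet C, |inner ℝ a p| ≤ 1 := fun a ha => abs_le.mpr ⟨by
    have := ha _ hnp
    rw [inner_neg_right] at this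
    linarith, ha _ hp⟩
  have hx₁ := abs_le.mp (hstrip y₁ hy₁)
  have hx₂ := abs_le.mp (hstrip y₂ hy₂)
  have hx₃ := abs_le.mp (hstrip y₃ hy₃)
  have ht₁ := abs_le.mp (hap a₁ ha₁)
  have ht₂ := abs_le.mp (hap a₂ ha₂)
  have e₁ := h₁
  have e₂ := h₂
  have e₃ := h₃
  have e₁₃ := ha₃ y₁ hy₁
  have e₂₃ := ha₃ y₂ hy₂
  have e₃₁ := ha₁ y₃ hy₃
  have e₃₂ := ha₂ y₃ hy₃
  rw [hin, hb₃] at e₃ e₁₃ e₂₃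
  rw [hin] at e₁ e₂ e₃₁ e₃₂
  have hW₃ : W y₃ = s + inner ℝ e y₃ * inner ℝ a₃ p := by linarith
  rw [hW₃] at e₃₁ e₃₂
  have key : s = Real.goldenRatio ∧ inner ℝ e y₃ = 0 ∧ inner ℝ a₃ p = 0 ∧ inner ℝ a₁ u = s - 1 ∧
      inner ℝ a₂ u = s - 1 ∧ inner ℝ a₁ p + inner ℝ a₁ u * inner ℝ a₃ p = 1 ∧
      inner ℝ a₂ p + inner ℝ a₂ u * inner ℝ a₃ p = -1 ∧
      inner ℝ e y₁ = -1 ∧ inner ℝ e y₂ = 1 := by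
    have g₁ : s ≤ inner ℝ a₁ u -
        (inner ℝ a₁ p + inner ℝ a₁ u * inner ℝ a₃ p) * inner ℝ e y₁ := by
      linarith [mul_le_mul_of_nonneg_left e₁₃ hb₁.le]
    have g₂ : s ≤ inner ℝ a₂ u -
        (inner ℝ a₂ p + inner ℝ a₂ u * inner ℝ a₃ p) * inner ℝ e y₂ := by
      linarith [mul_le_mul_of_nonneg_left e₂₃ hb₂.le]
    rcases le_total 0 (inner ℝ e y₃) with hpos | hneg
    · exact golden_core hs hx₁.1 hx₂.2 hpos hb₁ hτ₁ hτ₂ (by linarith) (by linarith) g₁ g₂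
        (by linarith) (by linarith) hx₃.2 (hap a₃ ha₃)
    -- The reflection of the first coordinate swaps the roles of `a₁` and `a₂`.
    · obtain ⟨k₀, k₁, k₂, k₃, k₄, k₅, k₆, k₇, k₈⟩ := golden_core (x₁ := -inner ℝ e y₂)
        (x₂ := -inner ℝ e y₁) (x₃ := -inner ℝ e y₃) (t := -inner ℝ a₃ p) (b₁ := inner ℝ a₂ u)
        (b₂ := inner ℝ a₁ u) (τ₁ := -(inner ℝ a₂ p + inner ℝ a₂ u * inner ℝ a₃ p))
        (τ₂ := -(inner ℝ a₁ p + inner ℝ a₁ u * inner ℝ a₃ p)) hs (by linarith) (by linarith)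
        (by linarith) hb₂ (by linarith) (by linarith) (by linarith) (by linarith) (by linarith)
        (by linarith) (by linarith) (by linarith) (by linarith)
        (by rw [abs_neg]; exact hap a₃ ha₃)
      refine ⟨k₀, ?_, ?_, k₄, k₃, ?_, ?_, ?_, ?_⟩ <;> linarith
  obtain ⟨hsg, k₁, k₂, k₃, k₄, k₅, k₆, k₇, k₈⟩ := key
  refine ⟨hsg, planarCoordinates hdecomp hep heu hWp hWu, ?_⟩
  have hs1 : 0 < s - 1 := by linarith [Real.one_lt_goldenRatio]
  have k₅' : inner ℝ a₁ p = 1 := by simpa [k₂] using k₅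
  have k₆' : inner ℝ a₂ p = -1 := by simpa [k₂] using k₆
  rw [k₅', k₃, k₇] at e₁
  rw [k₆', k₄, k₈] at e₂
  have w₁ : W y₁ = -1 := mul_right_cancel₀ hs1.ne' (by linarith)
  have w₂ : W y₂ = -1 := mul_right_cancel₀ hs1.ne' (by linarith)
  have w₃ : W y₃ = s := by simpa [k₁] using hW₃
  have hL : ∀ z, planarCoordinates hdecomp hep heu hWp hWu z = !₂[inner ℝ e z, W z] := fun _ => rfl
  apply Set.Subset.antisymm
  · rintro _ ⟨z, hz, rfl⟩
    have z₁ := ha₁ z hz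
    have z₂ := ha₂ z hz
    have z₃ := ha₃ z hz
    rw [hin] at z₁ z₂ z₃
    rw [k₅', k₃] at z₁
    rw [k₆', k₄] at z₂
    rw [k₂, hb₃] at z₃
    rw [hL]
    refine mem_goldenHouse (hstrip z hz) ?_ ?_ ?_
    · change -1 ≤ W z
      linarith
    · change inner ℝ e z + (Real.goldenRatio - 1) * W z ≤ 1
      rw [← hsg]
      linarith
    · change -inner ℝ e z + (Real.goldenRatio - 1) * W z ≤ 1
      rw [← hsg]
      linarith
  · refine convexHull_min ?_ (hC.linear_image (planarCoordinates hdecomp hep heu hWp hWu).toLinearMap)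
    rintro q (rfl | rfl | rfl | rfl | rfl)
    · exact ⟨y₁, hy₁, by simp [hL, k₇, w₁]⟩
    · exact ⟨-p, hnp, by simp [hL, hep, hWp]⟩
    · exact ⟨y₃, hy₃, by simp [hL, k₁, w₃, hsg]⟩
    · exact ⟨p, hp, by simp [hL, hep, hWp]⟩
    · exact ⟨y₂, hy₂, by simp [hL, k₈, w₂]⟩

/-- Rescaling `u` makes `⟪a₃, u⟫ = -1`. Evaluating the vanishing combination on `p + ⟪a₃, p⟫ v`,
where `a₃` vanishes, gives `w₁ τ₁ + w₂ τ₂ = 0`, so `τ₁`, `τ₂` have opposite signs up to swapping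
`a₁` and `a₂`. -/
theorem eq_goldenHouse_of_touching_triple {C : Set (EuclideanSpace ℝ (Fin 2))} (hC : Convex ℝ C)
    {p u e : EuclideanSpace ℝ (Fin 2)} {W : EuclideanSpace ℝ (Fin 2) →ₗ[ℝ] ℝ}
    (hdecomp : ∀ z, z = inner ℝ e z • p + W z • u) (hep : inner ℝ e p = 1)
    (heu : inner ℝ e u = 0) (hWp : W p = 0) (hWu : W u = 1)
    (hp : p ∈ C) (hnp : -p ∈ C) (hstrip : ∀ c ∈ C, |inner ℝ e c| ≤ 1)
    {s : ℝ} (hs : Real.goldenRatio ≤ s) {a₁ a₂ a₃ : EuclideanSpace ℝ (Fin 2)}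
    (ha₁ : a₁ ∈ {a | a ∈ polarSet C ∧ ∃ y ∈ C, inner ℝ a y = -s})
    (ha₂ : a₂ ∈ {a | a ∈ polarSet C ∧ ∃ y ∈ C, inner ℝ a y = -s})
    (ha₃ : a₃ ∈ {a | a ∈ polarSet C ∧ ∃ y ∈ C, inner ℝ a y = -s})
    {w₁ w₂ w₃ : ℝ} (hw₁ : 0 ≤ w₁) (hw₂ : 0 ≤ w₂) (hsum : w₁ + w₂ + w₃ = 1)
    (hcomb : w₁ • a₁ + w₂ • a₂ + w₃ • a₃ = 0)
    (hb₁ : inner ℝ a₁ u * inner ℝ a₃ u < 0) (hb₂ : inner ℝ a₂ u * inner ℝ a₃ u < 0) :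
    s = Real.goldenRatio ∧
      ∃ L : EuclideanSpace ℝ (Fin 2) ≃ₗ[ℝ] EuclideanSpace ℝ (Fin 2), L '' C = goldenHouse := by
  obtain ⟨ha₁, y₁, hy₁, h₁⟩ := ha₁
  obtain ⟨ha₂, y₂, hy₂, h₂⟩ := ha₂
  obtain ⟨ha₃, y₃, hy₃, h₃⟩ := ha₃
  have hcomb' : ∀ z, w₁ * inner ℝ a₁ z + w₂ * inner ℝ a₂ z + w₃ * inner ℝ a₃ z = 0 := fun z => by
    have := congrArg (fun a => inner ℝ a z) hcomb
    simpa only [inner_add_left, real_inner_smul_left, inner_zero_left] using this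
  set κ : ℝ := -inner ℝ a₃ u with hκ
  have hκ0 : κ ≠ 0 := fun h => by
    rw [neg_eq_zero.mp h, mul_zero] at hb₁
    exact lt_irrefl _ hb₁
  set v := κ⁻¹ • u with hv
  have hav : ∀ a, inner ℝ a v = κ⁻¹ * inner ℝ a u := fun a => real_inner_smul_right _ _ _
  have hb₃' : inner ℝ a₃ v = -1 := by
    rw [hav, show inner ℝ a₃ u = -κ by simp [hκ], mul_neg, inv_mul_cancel₀ hκ0]
  have hpos : ∀ a : EuclideanSpace ℝ (Fin 2), inner ℝ a u * inner ℝ a₃ u < 0 → 0 < inner ℝ a v :=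
    fun a ha => by
      have h2 : 0 < κ ^ 2 := by positivity
      have h3 : inner ℝ a v = -(inner ℝ a u * inner ℝ a₃ u) / κ ^ 2 := by
        rw [hav, show inner ℝ a₃ u = -κ by simp [hκ]]
        field_simp
      rw [h3]
      exact div_pos (neg_pos.mpr ha) h2
  have hb₁' := hpos a₁ hb₁
  have hb₂' := hpos a₂ hb₂
  have hdecomp' : ∀ z, z = inner ℝ e z • p + (κ • W) z • v := fun z => by
    rw [LinearMap.smul_apply, smul_eq_mul, mul_comm, mul_smul, hv, smul_inv_smul₀ hκ0]
    exact hdecomp z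
  have hWp' : (κ • W) p = 0 := by simp [hWp]
  have hWv : (κ • W) v = 1 := by simp [hv, hWu, hκ0]
  have hev : inner ℝ e v = 0 := by rw [hav, heu, mul_zero]
  have hτ : w₁ * (inner ℝ a₁ p + inner ℝ a₁ v * inner ℝ a₃ p) +
      w₂ * (inner ℝ a₂ p + inner ℝ a₂ v * inner ℝ a₃ p) = 0 := by
    have k₁ := hcomb' p
    have k₂ := hcomb' v
    rw [hb₃'] at k₂
    linear_combination k₁ + inner ℝ a₃ p * k₂
  have hw : 0 < w₁ ∨ 0 < w₂ := by
    by_contra! h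
    have h1 : w₁ = 0 := le_antisymm h.1 hw₁
    have h2 : w₂ = 0 := le_antisymm h.2 hw₂
    have k₂ := hcomb' v
    rw [hb₃', h1, h2] at k₂
    linarith
  set τ₁ := inner ℝ a₁ p + inner ℝ a₁ v * inner ℝ a₃ p with hτ₁
  set τ₂ := inner ℝ a₂ p + inner ℝ a₂ v * inner ℝ a₃ p with hτ₂
  have hsigns : (0 ≤ τ₁ ∧ τ₂ ≤ 0) ∨ (0 ≤ τ₂ ∧ τ₁ ≤ 0) := by
    rcases lt_trichotomy τ₁ 0 with k | k | k <;> rcases lt_trichotomy τ₂ 0 with l | l | l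
    · exfalso
      rcases hw with hw | hw <;> nlinarith
    · exact Or.inr ⟨l.ge, k.le⟩
    · exact Or.inr ⟨l.le, k.le⟩
    · exact Or.inl ⟨k.ge, l.le⟩
    · exact Or.inl ⟨k.ge, l.le⟩
    · exact Or.inr ⟨l.le, k.le⟩
    · exact Or.inl ⟨k.le, l.le⟩
    · exact Or.inl ⟨k.le, l.le⟩
    · exfalso
      rcases hw with hw | hw <;> nlinarith
  rcases hsigns with ⟨k₁, k₂⟩ | ⟨k₂, k₁⟩
  · exact eq_goldenHouse_of_normalized_touching hC hdecomp' hep hev hWp' hWv hp hnp hstrip hs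
      ha₁ ha₂ ha₃ hy₁ hy₂ hy₃ h₁ h₂ h₃ hb₁' hb₂' hb₃' k₁ k₂
  · exact eq_goldenHouse_of_normalized_touching hC hdecomp' hep hev hWp' hWv hp hnp hstrip hs
      ha₂ ha₁ ha₃ hy₂ hy₁ hy₃ h₂ h₁ h₃ hb₂' hb₁' hb₃' k₂ k₁

theorem exists_complementary_direction {e p : EuclideanSpace ℝ (Fin 2)} (hep : inner ℝ e p = 1) :
    ∃ (u : EuclideanSpace ℝ (Fin 2)) (W : EuclideanSpace ℝ (Fin 2) →ₗ[ℝ] ℝ),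
      (∀ z, z = inner ℝ e z • p + W z • u) ∧ inner ℝ e u = 0 ∧ W p = 0 ∧ W u = 1 := by
  have hep' : e 0 * p 0 + e 1 * p 1 = 1 := by
    rw [← hep]
    simp [PiLp.inner_apply, Fin.sum_univ_two, mul_comm]
  have hW : ∀ z : EuclideanSpace ℝ (Fin 2),
      innerₛₗ ℝ (!₂[-p 1, p 0] : EuclideanSpace ℝ (Fin 2)) z = p 0 * z 1 - p 1 * z 0 := fun z => by
    simp [PiLp.inner_apply, Fin.sum_univ_two]
    ring
  -- Quarter turns of `e` and `p`: `W` is the determinant with first column `p`.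
  refine ⟨!₂[-e 1, e 0], innerₛₗ ℝ !₂[-p 1, p 0], fun z => ?_, ?_, ?_, ?_⟩
  · rw [hW]
    ext i
    fin_cases i
    · simp [PiLp.inner_apply, Fin.sum_univ_two]
      linear_combination (-z 0) * hep'
    · simp [PiLp.inner_apply, Fin.sum_univ_two]
      linear_combination (-z 1) * hep'
  · simp [PiLp.inner_apply, Fin.sum_univ_two]
    ring
  · rw [hW]
    ring
  · rw [hW]
    simp
    linarith

theorem eq_goldenHouse_of_goldenRatio_le (C : Set (EuclideanSpace ℝ (Fin 2)))
    (hC : IsConvexBody C) (hcent : IsMinkowskiCentered C)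
    (hopt : OptimallyContained (harmonicSymmetrization C) (arithmeticSymmetrization C))
    (hs : Real.goldenRatio ≤ minkowskiAsymmetry C) :
    minkowskiAsymmetry C = Real.goldenRatio ∧
      ∃ L : EuclideanSpace ℝ (Fin 2) ≃ₗ[ℝ] EuclideanSpace ℝ (Fin 2), L '' C = goldenHouse := by
  have hs1 : 1 < minkowskiAsymmetry C := Real.one_lt_goldenRatio.trans_le hs
  have h0 := hcent.zero_mem_interior hC (by linarith)
  obtain ⟨p, e, hp, hnp, hep, hstrip⟩ := exists_antipodal_pair_of_optimallyContained hC h0 hopt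
  obtain ⟨u, W, hdecomp, heu, hWp, hWu⟩ := exists_complementary_direction hep
  obtain ⟨w, ⟨hw, hsum⟩, a, ha, hcomb⟩ := exists_three_point_convexComb
    (finrank_euclideanSpace_fin (𝕜 := ℝ) (n := 2))
    (zero_mem_convexHull_touching finrank_euclideanSpace_fin hC hcent (by linarith))
  rw [Fin.sum_univ_three] at hsum hcomb
  -- Otherwise `⟪a i, y⟫ = ⟪e, y⟫ ⟪a i, p⟫` has absolute value at most `1 < s`.
  have hne : ∀ i, inner ℝ (a i) u ≠ 0 := fun i hi => by
    obtain ⟨hai, y, hy, hay⟩ := ha i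
    rw [hdecomp y, inner_add_right, real_inner_smul_right, real_inner_smul_right, hi, mul_zero,
      add_zero] at hay
    have h1 : |inner ℝ (a i) p| ≤ 1 := abs_le.mpr ⟨by
      have := hai _ hnp
      rw [inner_neg_right] at this
      linarith, hai _ hp⟩
    have h2 := mul_le_one₀ (hstrip y hy) (abs_nonneg _) h1
    rw [← abs_mul, hay, abs_neg, abs_of_pos (by linarith)] at h2
    linarith
  have hu : w 0 * inner ℝ (a 0) u + w 1 * inner ℝ (a 1) u + w 2 * inner ℝ (a 2) u = 0 := by
    have := congrArg (fun b => inner ℝ b u) hcomb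
    simpa only [inner_add_left, real_inner_smul_left, inner_zero_left] using this
  have main := @eq_goldenHouse_of_touching_triple C hC.convex p u e W hdecomp hep heu hWp hWu hp
    hnp hstrip _ hs
  have m₂ := main (ha 0) (ha 1) (ha 2) (hw 0) (hw 1) hsum hcomb
  have m₁ := main (w₃ := w 1) (ha 0) (ha 2) (ha 1) (hw 0) (hw 2) (by linarith) (by rw [← hcomb]; abel)
  have m₀ := main (w₃ := w 0) (ha 1) (ha 2) (ha 0) (hw 1) (hw 2) (by linarith) (by rw [← hcomb]; abel)
  have w₀ := hw 0
  have w₁ := hw 1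
  have w₂ := hw 2
  -- Equal signs contradict the vanishing combination; otherwise the functional of isolated sign
  -- plays the role of `a₃`.
  rcases lt_or_gt_of_ne (hne 0) with k₀ | k₀ <;> rcases lt_or_gt_of_ne (hne 1) with k₁ | k₁ <;>
    rcases lt_or_gt_of_ne (hne 2) with k₂ | k₂
  · exfalso
    rcases lt_or_eq_of_le w₀ with h | h <;> rcases lt_or_eq_of_le w₁ with h' | h' <;> nlinarith
  · exact m₂ (mul_neg_of_neg_of_pos k₀ k₂) (mul_neg_of_neg_of_pos k₁ k₂)
  · exact m₁ (mul_neg_of_neg_of_pos k₀ k₁) (mul_neg_of_neg_of_pos k₂ k₁)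
  · exact m₀ (mul_neg_of_pos_of_neg k₁ k₀) (mul_neg_of_pos_of_neg k₂ k₀)
  · exact m₀ (mul_neg_of_neg_of_pos k₁ k₀) (mul_neg_of_neg_of_pos k₂ k₀)
  · exact m₁ (mul_neg_of_pos_of_neg k₀ k₁) (mul_neg_of_pos_of_neg k₂ k₁)
  · exact m₂ (mul_neg_of_pos_of_neg k₀ k₂) (mul_neg_of_pos_of_neg k₁ k₂)
  · exfalso
    rcases lt_or_eq_of_le w₀ with h | h <;> rcases lt_or_eq_of_le w₁ with h' | h' <;> nlinarith

theorem theorem1p2 (C : Set (EuclideanSpace ℝ (Fin 2))) (hC : IsConvexBody C)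
    (hcent : IsMinkowskiCentered C)
    (hopt : OptimallyContained (harmonicSymmetrization C) (arithmeticSymmetrization C)) :
    minkowskiAsymmetry C ≤ Real.goldenRatio ∧
      (minkowskiAsymmetry C = Real.goldenRatio →
        ∃ L : EuclideanSpace ℝ (Fin 2) ≃ₗ[ℝ] EuclideanSpace ℝ (Fin 2),
          L '' C = goldenHouse) := by
  refine ⟨?_, fun h => (eq_goldenHouse_of_goldenRatio_le C hC hcent hopt h.ge).2⟩
  rcases le_total (minkowskiAsymmetry C) Real.goldenRatio with h | h
  · exact h
  · exact (eq_goldenHouse_of_goldenRatio_le C hC hcent hopt h).1.le
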